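/- **Theorem 4.5 (Semiring Jacobson–Chevalley density theorem).** A *hemiring* is an algebra $(R,+,\cdot,0)$ such that $(R,+,0)$ is a commutative monoid, $(R,\cdot)$ is a semigroup, multiplication distributes over addition on both sides, and $0r=0=r0$ for all $r\in R$ (no identity element is required). A *left $R$-semimodule* is a commutative monoid $(M,+,0)$ with a scalar multiplication $R\times M\to M$ satisfying $(rs)m=r(sm)$, $r(m+n)=rm+rn$, $(r+s)m=rm+sm$ and $r0=0=0m$. It is *irreducible* if $M\neq 0$, $M$ is cancellative ($x+z=y+z$ implies $x=y$), and for all $m_1\neq m_2$ in $M$ and all $m\in M$ there are $r_1,r_2\in R$ with $$m+r_1m_1+r_2m_2=r_1m_2+r_2m_1 .$$ It is *faithful* if $\{r\in R\mid rM=0\}=\{0\}$. The hemiring $R$ is *primitive* if it has a faithful irreducible left semimodule. A *semiisomorphism* $R\to S$ is a surjective homomorphism of hemirings $f$ with $f^{-1}(0)=\{0\}$; if one exists, $R$ is said to be *semiisomorphic* to $S$. The *ring of differences* $D(S)$ of a hemiring $S$ is the ring (not necessarily with identity) of formal differences $a-b$ of elements $a,b\in S$, where $a-b=c-d$ iff $a+d+x=c+b+x$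 for some $x\in S$, with the evident addition and with $(a-b)(c-d)=(ac+bd)-(ad+bc)$. For a vector space $V$ over a division ring $F$, with linear transformations multiplied by composition, $(gh)(v)=g(h(v))$, a subring $T\subseteq \mathrm{End}_F(V)$ (not required to contain the identity) is *dense* if for all linearly independent $v_1,\dots,v_n\in V$ and all $w_1,\dots,w_n\in V$ there is $t\in T$ with $t(v_i)=w_i$ for $i=1,\dots,n$. A hemiring $R$ is primitive if and only if $R$ is semiisomorphic to an additively cancellative hemiring $S$ whose ring of differences $D(S)$ is isomorphic to a dense ring of linear transformations of a nonzero vector space over a division ring. -/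

import Mathlib

universe u v

/-- A left semimodule over a hemiring `R` (a hemiring is a `NonUnitalSemiring`). No unitality is
required, since `R` need not have an identity. -/
class LeftSemimodule (R : Type u) (M : Type v) [NonUnitalSemiring R] [AddCommMonoid M]
    extends SMul R M where
  mul_smul : ∀ (r s : R) (m : M), (r * s) • m = r • (s • m)
  smul_add : ∀ (r : R) (m n : M), r • (m + n) = r • m + r • n
  add_smul : ∀ (r s : R) (m : M), (r + s) • m = r • m + s • m
  smul_zero : ∀ r : R, r • (0 : M) = 0
  zero_smul : ∀ m : M, (0 : R) • m = 0

/-- A left semimodule is irreducible if it is nonzero, cancellative, and for all `m₁ ≠ m₂` and all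
`m` there are `r₁, r₂` with `m + r₁ m₁ + r₂ m₂ = r₁ m₂ + r₂ m₁`. -/
structure LeftSemimodule.IsIrreducible (R : Type u) (M : Type v) [NonUnitalSemiring R]
    [AddCommMonoid M] [LeftSemimodule R M] : Prop where
  nontrivial : Nontrivial M
  cancellative : ∀ x y z : M, x + z = y + z → x = y
  exists_eq : ∀ m₁ m₂ : M, m₁ ≠ m₂ → ∀ m : M, ∃ r₁ r₂ : R,
    m + r₁ • m₁ + r₂ • m₂ = r₁ • m₂ + r₂ • m₁

/-- A left semimodule is faithful if its annihilator is zero. For semimodules this does not say that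
distinct scalars act differently. -/
def LeftSemimodule.IsFaithful (R : Type u) (M : Type v) [NonUnitalSemiring R]
    [AddCommMonoid M] [LeftSemimodule R M] : Prop :=
  ∀ r : R, (∀ m : M, r • m = 0) → r = 0

/-- A hemiring is primitive if it has a faithful irreducible left semimodule. Taking the semimodule
in the universe of `R` loses nothing: if `m₁ ≠ m₂` in an irreducible `M`, the defining condition
embeds `M` into a quotient of `R × R`. -/
def IsPrimitiveHemiring (R : Type u) [NonUnitalSemiring R] : Prop :=
  ∃ (M : Type u) (_ : AddCommMonoid M) (_ : LeftSemimodule R M),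
    LeftSemimodule.IsIrreducible R M ∧ LeftSemimodule.IsFaithful R M

/-- A semiisomorphism is a surjective homomorphism of hemirings with zero kernel (it need not be
injective). -/
def IsSemiisomorphism {R : Type u} {S : Type v} [NonUnitalSemiring R] [NonUnitalSemiring S]
    (f : R →ₙ+* S) : Prop :=
  Function.Surjective f ∧ ∀ r : R, f r = 0 → r = 0

/-- The ring of differences of a hemiring: its additive group is the group of formal differences of
the additive monoid of `S`. The multiplication is given below. -/
def RingOfDifferences (S : Type u) [NonUnitalSemiring S] : Type u :=
  Algebra.GrothendieckAddGroup S

namespace RingOfDifferences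

variable {S : Type u} [NonUnitalSemiring S]

noncomputable instance : AddCommGroup (RingOfDifferences S) :=
  inferInstanceAs (AddCommGroup (Algebra.GrothendieckAddGroup S))

/-- The canonical map `S → D(S)`. -/
noncomputable def of : S →+ RingOfDifferences S :=
  (Algebra.GrothendieckAddGroup.of : S →+ Algebra.GrothendieckAddGroup S)

/-- An additive map from `S` to an abelian group extends to `D(S)`. -/
noncomputable def lift {G : Type v} [AddCommGroup G] (f : S →+ G) : RingOfDifferences S →+ G :=
  (Algebra.GrothendieckAddGroup.lift f : Algebra.GrothendieckAddGroup S →+ G)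

@[simp]
theorem lift_of {G : Type v} [AddCommGroup G] (f : S →+ G) (a : S) : lift f (of a) = f a :=
  DFunLike.congr_fun (Algebra.GrothendieckAddGroup.lift.symm_apply_apply f) a

theorem of_eq_of_iff {a b : S} : (of a : RingOfDifferences S) = of b ↔ ∃ c, a + c = b + c := by
  change (AddLocalization.addMonoidOf (⊤ : AddSubmonoid S)) a =
    (AddLocalization.addMonoidOf (⊤ : AddSubmonoid S)) b ↔ _
  rw [(AddLocalization.addMonoidOf (⊤ : AddSubmonoid S)).eq_iff_exists]
  constructor
  · rintro ⟨c, hc⟩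
    exact ⟨c, by rw [add_comm a, add_comm b]; exact hc⟩
  · rintro ⟨c, hc⟩
    exact ⟨⟨c, trivial⟩, by rw [add_comm a, add_comm b] at hc; exact hc⟩

/-- Every element of `D(S)` is a difference of two elements of `S`. -/
theorem exists_eq_sub (x : RingOfDifferences S) : ∃ a b : S, x = of a - of b := by
  obtain ⟨⟨a, b⟩, h⟩ := (AddLocalization.addMonoidOf (⊤ : AddSubmonoid S)).surj x
  exact ⟨a, b, eq_sub_of_add_eq h⟩

/-- The biadditive extension to `D(S)` of the multiplication of `S`. -/
noncomputable def mulHom : RingOfDifferences S →+ RingOfDifferences S →+ RingOfDifferences S :=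
  lift
    { toFun := fun a => lift (of.comp (AddMonoidHom.mulLeft a))
      map_zero' := by
        ext x
        obtain ⟨c, d, rfl⟩ := exists_eq_sub x
        simp
      map_add' := fun a b => by
        ext x
        obtain ⟨c, d, rfl⟩ := exists_eq_sub x
        simp [add_mul]
        abel }

noncomputable instance : Mul (RingOfDifferences S) := ⟨fun x y => mulHom x y⟩

@[simp]
theorem of_mul_of (a b : S) : (of a * of b : RingOfDifferences S) = of (a * b) := by
  change mulHom (of a) (of b) = _
  simp [mulHom]

noncomputable instance : NonUnitalNonAssocRing (RingOfDifferences S) where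
  __ := (inferInstance : AddCommGroup (RingOfDifferences S))
  __ := (inferInstance : Mul (RingOfDifferences S))
  left_distrib x y z := map_add (mulHom x) y z
  right_distrib x y z := by
    change mulHom (x + y) z = mulHom x z + mulHom y z
    rw [map_add, AddMonoidHom.add_apply]
  zero_mul x := by
    change mulHom 0 x = 0
    rw [map_zero, AddMonoidHom.zero_apply]
  mul_zero x := map_zero (mulHom x)

/-- The multiplication of formal differences: `(a - b)(c - d) = (ac + bd) - (ad + bc)`. -/
theorem sub_mul_sub (a b c d : S) :
    ((of a - of b) * (of c - of d) : RingOfDifferences S) =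
      of (a * c + b * d) - of (a * d + b * c) := by
  simp only [sub_mul, mul_sub, of_mul_of, map_add]
  abel

noncomputable instance : NonUnitalRing (RingOfDifferences S) where
  mul_assoc x y z := by
    obtain ⟨a, b, rfl⟩ := exists_eq_sub x
    obtain ⟨c, d, rfl⟩ := exists_eq_sub y
    obtain ⟨e, f, rfl⟩ := exists_eq_sub z
    simp only [sub_mul, mul_sub, of_mul_of, mul_assoc]

end RingOfDifferences

/-- A (not necessarily unital) ring `T` of linear transformations of `V` is dense if any finite
linearly independent family can be sent to any family of the same length by an element of `T`.
Multiplication in `Module.End F V` is composition `(f * g) v = f (g v)`. -/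
def IsDenseRingOfLinearMaps {F : Type u} {V : Type v} [DivisionRing F] [AddCommGroup V]
    [Module F V] (T : NonUnitalSubring (Module.End F V)) : Prop :=
  ∀ (n : ℕ) (x y : Fin n → V), LinearIndependent F x → ∃ f ∈ T, ∀ i, f (x i) = y i

/-! Pass from hemirings to rings by taking differences. If `M` is faithful and irreducible, let `S`
be the image of `R` in the additive endomorphisms of `M`. Faithfulness only gives `R → S` zero
kernel, hence a semiisomorphism. As `M` is cancellative, it embeds in its group of differences `V`,
and `D(S)` acts faithfully on `V`. Irreducibility says exactly that a nonzero difference `m₁ - m₂`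
can be moved to any `m` in `M`, so `D(S)` moves any nonzero vector of `V` to any other vector.
Schur's lemma and Jacobson density for rings without identity (`commutant_isUnit_or_eq_zero`,
`exists_ringEquiv_dense`) then apply over the commutant. Conversely, `R` acts on `V` through `S` and
`D(S)`, and density for a single vector is irreducibility. -/

/-- The extension of a homomorphism from a hemiring to a ring to the ring of differences. -/
noncomputable def RingOfDifferences.liftRingHom {S : Type u} [NonUnitalSemiring S] {E : Type v}
    [NonUnitalRing E] (f : S →ₙ+* E) : RingOfDifferences S →ₙ+* E where
  __ := RingOfDifferences.lift (f : S →+ E)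
  map_mul' x y := by
    obtain ⟨a, b, rfl⟩ := RingOfDifferences.exists_eq_sub x
    obtain ⟨c, d, rfl⟩ := RingOfDifferences.exists_eq_sub y
    change RingOfDifferences.lift (f : S →+ E) _ = RingOfDifferences.lift (f : S →+ E) _ *
      RingOfDifferences.lift (f : S →+ E) _
    rw [RingOfDifferences.sub_mul_sub]
    simp only [map_sub, RingOfDifferences.lift_of, map_add, AddMonoidHom.coe_coe, map_mul, sub_mul,
      mul_sub]
    abel

theorem RingOfDifferences.liftRingHom_of {S : Type u} [NonUnitalSemiring S] {E : Type v}
    [NonUnitalRing E] (f : S →ₙ+* E) (a : S) :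
    RingOfDifferences.liftRingHom f (RingOfDifferences.of a) = f a :=
  RingOfDifferences.lift_of (f : S →+ E) a

theorem RingOfDifferences.liftRingHom_of_sub_of {S : Type u} [NonUnitalSemiring S] {E : Type v}
    [NonUnitalRing E] (f : S →ₙ+* E) (a b : S) :
    RingOfDifferences.liftRingHom f (RingOfDifferences.of a - RingOfDifferences.of b) =
      f a - f b := by
  rw [map_sub, RingOfDifferences.liftRingHom_of, RingOfDifferences.liftRingHom_of]

theorem RingOfDifferences.liftRingHom_injective {S : Type u} [NonUnitalSemiring S] {E : Type v}
    [NonUnitalRing E] {f : S →ₙ+* E} (hf : Function.Injective f) :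
    Function.Injective (RingOfDifferences.liftRingHom f) := by
  rw [injective_iff_map_eq_zero]
  intro x hx
  obtain ⟨a, b, rfl⟩ := RingOfDifferences.exists_eq_sub x
  rw [RingOfDifferences.liftRingHom_of_sub_of, sub_eq_zero] at hx
  rw [hf hx, sub_self]

/-! ### Groups of differences and their endomorphisms -/

namespace Algebra.GrothendieckAddGroup

variable {M : Type u} [AddCommMonoid M]

theorem exists_eq_of_sub_of (x : GrothendieckAddGroup M) :
    ∃ a b : M, x = of a - of b := by
  obtain ⟨⟨a, b⟩, h⟩ := (AddLocalization.addMonoidOf (⊤ : AddSubmonoid M)).surj x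
  exact ⟨a, b, eq_sub_of_add_eq h⟩

theorem of_injective_of_cancel (hM : ∀ x y z : M, x + z = y + z → x = y) :
    Function.Injective (of : M →+ GrothendieckAddGroup M) := by
  intro a b hab
  change (AddLocalization.addMonoidOf (⊤ : AddSubmonoid M)) a =
    (AddLocalization.addMonoidOf (⊤ : AddSubmonoid M)) b at hab
  rw [(AddLocalization.addMonoidOf (⊤ : AddSubmonoid M)).eq_iff_exists] at hab
  obtain ⟨c, hc⟩ := hab
  exact hM a b c (by rw [add_comm a, add_comm b]; exact hc)

theorem lift_apply_of {G : Type v} [AddCommGroup G] (f : M →+ G) (a : M) :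
    lift f (of a) = f a :=
  DFunLike.congr_fun (lift.symm_apply_apply f) a

/-- The action of the additive endomorphisms of a monoid on its group of differences. -/
noncomputable def mapEnd : AddMonoid.End M →ₙ+* AddMonoid.End (GrothendieckAddGroup M) where
  toFun g := lift (of.comp g)
  map_zero' := AddMonoidHom.ext fun x => by
    obtain ⟨a, b, rfl⟩ := exists_eq_of_sub_of x
    rw [map_sub]
    erw [lift_apply_of]
    exact sub_self _
  map_add' g h := AddMonoidHom.ext fun x => by
    obtain ⟨a, b, rfl⟩ := exists_eq_of_sub_of x
    change _ = lift (of.comp g) (of a - of b) + lift (of.comp h) (of a - of b)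
    rw [map_sub, map_sub, map_sub, lift_apply_of, lift_apply_of, lift_apply_of, lift_apply_of]
    erw [lift_apply_of, lift_apply_of]
    change of (g a + h a) - of (g b + h b) = of (g a) - of (g b) + (of (h a) - of (h b))
    rw [map_add, map_add]
    abel
  map_mul' g h := AddMonoidHom.ext fun x => by
    obtain ⟨a, b, rfl⟩ := exists_eq_of_sub_of x
    change _ = lift (of.comp g) (lift (of.comp h) (of a - of b))
    simp only [map_sub, lift_apply_of]
    erw [lift_apply_of, lift_apply_of]
    rfl

theorem mapEnd_of (g : AddMonoid.End M) (a : M) : mapEnd g (of a) = of (g a) :=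
  lift_apply_of _ a

/-- Cancellation embeds `M` in its group of differences, so an endomorphism of `M` is recovered from
its extension by restriction. This makes the action of `D(S)` faithful. -/
theorem mapEnd_injective_of_cancel (hM : ∀ x y z : M, x + z = y + z → x = y) :
    Function.Injective (mapEnd : AddMonoid.End M → AddMonoid.End (GrothendieckAddGroup M)) := by
  intro g h hgh
  ext a
  apply of_injective_of_cancel hM
  rw [← mapEnd_of, ← mapEnd_of, hgh]

end Algebra.GrothendieckAddGroup

/-! ### Schur's lemma and Jacobson density without identity -/

section Density

variable {D : Type u} {V : Type v} [NonUnitalRing D] [AddCommGroup V]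

/-- The ring of additive maps commuting with the action of `D` on `V`. -/
abbrev commutant (φ : D →ₙ+* AddMonoid.End V) : Subring (AddMonoid.End V) :=
  Subring.centralizer (Set.range φ)

variable {φ : D →ₙ+* AddMonoid.End V}

theorem NonUnitalRingHom.map_add_apply_end (φ : D →ₙ+* AddMonoid.End V) (a b : D) (x : V) :
    φ (a + b) x = φ a x + φ b x :=
  DFunLike.congr_fun (map_add φ a b) x

theorem NonUnitalRingHom.map_sub_apply_end (φ : D →ₙ+* AddMonoid.End V) (a b : D) (x : V) :
    φ (a - b) x = φ a x - φ b x :=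
  DFunLike.congr_fun (map_sub φ a b) x

theorem NonUnitalRingHom.map_mul_apply_end (φ : D →ₙ+* AddMonoid.End V) (a b : D) (x : V) :
    φ (a * b) x = φ a (φ b x) :=
  DFunLike.congr_fun (map_mul φ a b) x

theorem NonUnitalRingHom.map_sum_apply_end {ι : Type*} (φ : D →ₙ+* AddMonoid.End V) (s : Finset ι)
    (f : ι → D) (x : V) : φ (∑ i ∈ s, f i) x = ∑ i ∈ s, φ (f i) x :=
  (DFunLike.congr_fun (map_sum φ f s) x).trans
    (AddMonoidHom.finsetSum_apply (fun i => (φ (f i) : V →+ V)) s x)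

theorem commutant_apply_comm (c : commutant φ) (d : D) (x : V) :
    c.1 (φ d x) = φ d (c.1 x) := by
  have h := Subring.mem_centralizer_iff.1 c.2 (φ d) ⟨d, rfl⟩
  exact (DFunLike.congr_fun h x).symm

theorem mem_commutant_of_apply_comm {g : AddMonoid.End V}
    (h : ∀ d x, g (φ d x) = φ d (g x)) : g ∈ commutant φ := by
  rw [Subring.mem_centralizer_iff]
  rintro _ ⟨d, rfl⟩
  ext x
  exact (h d x).symm

/-- Schur's lemma for a transitive action of a ring without identity. -/
theorem commutant_isUnit_or_eq_zero (h : ∀ x : V, x ≠ 0 → ∀ y, ∃ d, φ d x = y)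
    (c : commutant φ) : IsUnit c ∨ c = 0 := by
  rw [or_iff_not_imp_right]
  intro hc
  obtain ⟨x₀, hx₀⟩ : ∃ x, c.1 x ≠ 0 := by
    by_contra! hz
    exact hc (Subtype.ext (AddMonoidHom.ext hz))
  -- A nonzero vector killed by `c` could be moved to `x₀`, and `c` would kill `x₀` too.
  have hinj : Function.Injective c.1 := by
    rw [injective_iff_map_eq_zero]
    intro x hx
    by_contra hx0
    obtain ⟨d, hd⟩ := h x hx0 x₀
    rw [← hd, commutant_apply_comm, hx, map_zero] at hx₀
    exact hx₀ rfl
  have hsurj : Function.Surjective c.1 := by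
    intro y
    obtain ⟨d, hd⟩ := h _ hx₀ y
    exact ⟨φ d x₀, by rw [commutant_apply_comm, hd]⟩
  let e : V ≃+ V := AddEquiv.ofBijective c.1 ⟨hinj, hsurj⟩
  have he : ∀ x, e x = c.1 x := fun _ => rfl
  let g : AddMonoid.End V := (e.symm : V →+ V)
  have hg : ∀ x, c.1 (g x) = x := e.apply_symm_apply
  have hg' : ∀ x, g (c.1 x) = x := e.symm_apply_apply
  have hgmem : g ∈ commutant φ := mem_commutant_of_apply_comm fun d x => by
    apply hinj
    rw [hg, commutant_apply_comm, hg]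
  exact ⟨⟨c, ⟨g, hgmem⟩, Subtype.ext (AddMonoidHom.ext hg), Subtype.ext (AddMonoidHom.ext hg')⟩,
    rfl⟩

/-- The action of `D` on `V` by linear maps over the commutant. -/
def toLinearEnd (φ : D →ₙ+* AddMonoid.End V) : D →ₙ+* Module.End (commutant φ) V where
  toFun d :=
    { toFun := φ d
      map_add' := map_add (φ d)
      map_smul' := fun c x => (commutant_apply_comm c d x).symm }
  map_zero' := by
    ext x
    exact DFunLike.congr_fun (map_zero φ) x
  map_add' a b := by
    ext x
    exact DFunLike.congr_fun (map_add φ a b) x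
  map_mul' a b := by
    ext x
    exact DFunLike.congr_fun (map_mul φ a b) x

theorem toLinearEnd_apply (d : D) (x : V) : toLinearEnd φ d x = φ d x := rfl

/-- A transitive action separates a vector from a finite-dimensional subspace not containing it. -/
theorem exists_annihilating_apply_ne_zero (h : ∀ x : V, x ≠ 0 → ∀ y, ∃ d, φ d x = y)
    (s : Finset V) : ∀ z, z ∉ Submodule.span (commutant φ) (s : Set V) →
      ∃ d, (∀ x ∈ s, φ d x = 0) ∧ φ d z ≠ 0 := by
  classical
  induction s using Finset.induction_on with
  | empty =>
    intro z hz
    have hz0 : z ≠ 0 := by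
      rintro rfl
      exact hz (Submodule.zero_mem _)
    obtain ⟨d, hd⟩ := h z hz0 z
    exact ⟨d, by simp, by rwa [hd]⟩
  | insert w s _ ih =>
    intro z hz
    rw [Finset.coe_insert] at hz
    -- Suppose everything that kills `w` and `s` also kills `z`. Then `φ d w ↦ φ d z`, for `d`
    -- killing `s`, will define an element `c` of the commutant.
    by_contra! hcon
    have hw : w ∉ Submodule.span (commutant φ) (s : Set V) := by
      intro hw
      rw [Submodule.span_insert_eq_span hw] at hz
      obtain ⟨d, hd, hdz⟩ := ih z hz
      refine hdz (hcon d fun x hx => ?_)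
      have hle : Submodule.span (commutant φ) (s : Set V) ≤ LinearMap.ker (toLinearEnd φ d) :=
        Submodule.span_le.2 hd
      rcases Finset.mem_insert.1 hx with rfl | hx
      · exact hle hw
      · exact hd x hx
    obtain ⟨d₀, hd₀, hd₀w⟩ := ih w hw
    have hex : ∀ y, ∃ d, (∀ x ∈ s, φ d x = 0) ∧ φ d w = y := by
      intro y
      obtain ⟨b, hb⟩ := h _ hd₀w y
      refine ⟨b * d₀, fun x hx => ?_, ?_⟩
      · rw [φ.map_mul_apply_end, hd₀ x hx, map_zero]
      · rw [φ.map_mul_apply_end, hb]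
    choose g hgs hgw using hex
    have huniq : ∀ a b, (∀ x ∈ s, φ a x = 0) → (∀ x ∈ s, φ b x = 0) → φ a w = φ b w →
        φ a z = φ b z := by
      intro a b ha hb hab
      have := hcon (a - b) fun x hx => by
        rw [φ.map_sub_apply_end, sub_eq_zero]
        rcases Finset.mem_insert.1 hx with rfl | hx
        · exact hab
        · rw [ha x hx, hb x hx]
      rwa [φ.map_sub_apply_end, sub_eq_zero] at this
    let c : AddMonoid.End V := AddMonoidHom.mk' (fun y => φ (g y) z) fun x y => by
      rw [← φ.map_add_apply_end]
      refine huniq _ _ (hgs _) (fun v hv => ?_) ?_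
      · rw [φ.map_add_apply_end, hgs x v hv, hgs y v hv, add_zero]
      · rw [φ.map_add_apply_end, hgw, hgw, hgw]
    have hc : ∀ a, (∀ x ∈ s, φ a x = 0) → c (φ a w) = φ a z := fun a ha =>
      huniq _ _ (hgs _) ha (hgw _)
    have hcmem : c ∈ commutant φ := mem_commutant_of_apply_comm fun d x => by
      have := hc (d * g x) fun v hv => by
        rw [φ.map_mul_apply_end, hgs x v hv, map_zero]
      rwa [φ.map_mul_apply_end, φ.map_mul_apply_end, hgw] at this
    -- Whatever kills `s` kills `z - c w`, so the induction hypothesis puts this vector in the span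
    -- of `s`.
    have hmem : z - c w ∈ Submodule.span (commutant φ) (s : Set V) := by
      by_contra hn
      obtain ⟨a, ha, haz⟩ := ih _ hn
      apply haz
      rw [map_sub, ← commutant_apply_comm ⟨c, hcmem⟩, hc a ha, sub_self]
    apply hz
    rw [Submodule.mem_span_insert]
    exact ⟨⟨c, hcmem⟩, _, hmem, (add_sub_cancel (c w) z).symm⟩

/-- The Jacobson density theorem for a transitive action of a ring without identity. -/
theorem exists_forall_apply_eq (h : ∀ x : V, x ≠ 0 → ∀ y, ∃ d, φ d x = y)
    [Nontrivial (commutant φ)] {n : ℕ} {x : Fin n → V} (y : Fin n → V)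
    (hx : LinearIndependent (commutant φ) x) : ∃ d, ∀ i, φ d (x i) = y i := by
  classical
  have key : ∀ i, ∃ d, (∀ j, j ≠ i → φ d (x j) = 0) ∧ φ d (x i) = y i := by
    intro i
    have hi := hx.notMem_span_image (s := {j | j ≠ i}) (x := i) (by simp)
    have hset : (((Finset.univ.erase i).image x : Finset V) : Set V) = x '' {j | j ≠ i} := by
      ext v
      simp
    rw [← hset] at hi
    obtain ⟨d, hd, hdi⟩ := exists_annihilating_apply_ne_zero h _ _ hi
    obtain ⟨b, hb⟩ := h _ hdi (y i)
    refine ⟨b * d, fun j hj => ?_, ?_⟩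
    · rw [φ.map_mul_apply_end,
        hd _ (Finset.mem_image_of_mem x (Finset.mem_erase.2 ⟨hj, Finset.mem_univ j⟩)), map_zero]
    · rw [φ.map_mul_apply_end, hb]
  choose d hd hdi using key
  refine ⟨∑ j, d j, fun i => ?_⟩
  rw [φ.map_sum_apply_end, Finset.sum_eq_single i, hdi]
  · exact fun j _ hj => hd j i hj.symm
  · simp

/-- A ring acting faithfully and transitively is isomorphic to a dense ring of linear maps. -/
theorem exists_ringEquiv_dense [Nontrivial V] (hφ : Function.Injective φ)
    (h : ∀ x : V, x ≠ 0 → ∀ y, ∃ d, φ d x = y) :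
    ∃ (F : Type v) (_ : DivisionRing F) (_ : Module F V) (T : NonUnitalSubring (Module.End F V)),
      IsDenseRingOfLinearMaps T ∧ Nonempty (D ≃+* T) := by
  classical
  have hnt : Nontrivial (commutant φ) := by
    refine ⟨0, 1, fun h01 => ?_⟩
    obtain ⟨x, hx⟩ := exists_ne (0 : V)
    exact hx (DFunLike.congr_fun (congrArg Subtype.val h01) x).symm
  let _ : DivisionRing (commutant φ) :=
    DivisionRing.ofIsUnitOrEqZero (commutant_isUnit_or_eq_zero h)
  have hinj : Function.Injective (toLinearEnd φ) := fun a b hab =>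
    hφ (AddMonoidHom.ext fun x => LinearMap.congr_fun hab x)
  refine ⟨commutant φ, inferInstance, inferInstance, (toLinearEnd φ).range, ?_,
    ⟨RingEquiv.ofBijective (toLinearEnd φ).rangeRestrict
      ⟨fun a b hab => hinj (congrArg Subtype.val hab), ?_⟩⟩⟩
  · intro n x y hx
    obtain ⟨d, hd⟩ := exists_forall_apply_eq h y hx
    exact ⟨toLinearEnd φ d, ⟨d, rfl⟩, hd⟩
  · rintro ⟨_, d, rfl⟩
    exact ⟨d, rfl⟩

end Density

/-! ### The two implications -/

/-- The action of a hemiring on a left semimodule. -/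
def LeftSemimodule.toEnd (R : Type u) (M : Type v) [NonUnitalSemiring R] [AddCommMonoid M]
    [LeftSemimodule R M] : R →ₙ+* AddMonoid.End M where
  toFun r :=
    { toFun := fun m => r • m
      map_zero' := LeftSemimodule.smul_zero r
      map_add' := LeftSemimodule.smul_add r }
  map_zero' := AddMonoidHom.ext LeftSemimodule.zero_smul
  map_add' r s := AddMonoidHom.ext (LeftSemimodule.add_smul r s)
  map_mul' r s := AddMonoidHom.ext (LeftSemimodule.mul_smul r s)

theorem IsPrimitiveHemiring.exists_semiisomorphism {R : Type u} [NonUnitalSemiring R]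
    (hR : IsPrimitiveHemiring R) :
    ∃ (S : Type u) (_ : NonUnitalSemiring S) (f : R →ₙ+* S),
      IsSemiisomorphism f ∧ IsCancelAdd S ∧
      ∃ (F V : Type u) (_ : DivisionRing F) (_ : AddCommGroup V) (_ : Module F V)
        (T : NonUnitalSubring (Module.End F V)),
        Nontrivial V ∧ IsDenseRingOfLinearMaps T ∧ Nonempty (RingOfDifferences S ≃+* T) := by
  obtain ⟨M, _, _, hirr, hfaith⟩ := hR
  let ρ := LeftSemimodule.toEnd R M
  let S := NonUnitalRingHom.srange ρ
  let ρ' : R →ₙ+* S := NonUnitalRingHom.srangeRestrict ρ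
  let ι : S →ₙ+* AddMonoid.End M := NonUnitalSubsemiringClass.subtype S
  let φ : RingOfDifferences S →ₙ+* AddMonoid.End (Algebra.GrothendieckAddGroup M) :=
    RingOfDifferences.liftRingHom (Algebra.GrothendieckAddGroup.mapEnd.comp ι)
  have hofinj := Algebra.GrothendieckAddGroup.of_injective_of_cancel hirr.cancellative
  have hφ : Function.Injective φ := RingOfDifferences.liftRingHom_injective
    ((Algebra.GrothendieckAddGroup.mapEnd_injective_of_cancel hirr.cancellative).comp
      Subtype.val_injective)
  have := hirr.nontrivial
  have hnt : Nontrivial (Algebra.GrothendieckAddGroup M) := hofinj.nontrivial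
  have hone : ∀ x : Algebra.GrothendieckAddGroup M, x ≠ 0 → ∀ m : M,
      ∃ d, φ d x = Algebra.GrothendieckAddGroup.of m := by
    intro x hx m
    obtain ⟨a, b, rfl⟩ := Algebra.GrothendieckAddGroup.exists_eq_of_sub_of x
    obtain ⟨r, s, hrs⟩ := hirr.exists_eq a b (fun hab => hx (by rw [hab, sub_self])) m
    have hrs' := congrArg (Algebra.GrothendieckAddGroup.of : M → _) hrs
    simp only [map_add] at hrs'
    -- In the group of differences, `hrs` reads `m = (s - r)(a - b)`.
    refine ⟨RingOfDifferences.of (ρ' s) - RingOfDifferences.of (ρ' r), ?_⟩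
    rw [φ.map_sub_apply_end, map_sub, map_sub]
    simp only [φ, RingOfDifferences.liftRingHom_of]
    change Algebra.GrothendieckAddGroup.mapEnd (ρ s) _ - Algebra.GrothendieckAddGroup.mapEnd (ρ s) _
      - (Algebra.GrothendieckAddGroup.mapEnd (ρ r) _ -
        Algebra.GrothendieckAddGroup.mapEnd (ρ r) _) = _
    simp only [Algebra.GrothendieckAddGroup.mapEnd_of]
    change Algebra.GrothendieckAddGroup.of (s • a) - Algebra.GrothendieckAddGroup.of (s • b) -
      (Algebra.GrothendieckAddGroup.of (r • a) - Algebra.GrothendieckAddGroup.of (r • b)) = _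
    rw [sub_sub_eq_add_sub, sub_eq_iff_eq_add, sub_add_eq_add_sub, sub_eq_iff_eq_add, hrs']
    abel
  have htrans : ∀ x : Algebra.GrothendieckAddGroup M, x ≠ 0 → ∀ y, ∃ d, φ d x = y := by
    intro x hx y
    obtain ⟨a, b, rfl⟩ := Algebra.GrothendieckAddGroup.exists_eq_of_sub_of y
    obtain ⟨d, hd⟩ := hone x hx a
    obtain ⟨e, he⟩ := hone x hx b
    exact ⟨d - e, by rw [φ.map_sub_apply_end, hd, he]⟩
  obtain ⟨F, _, _, T, hT, hDT⟩ := exists_ringEquiv_dense hφ htrans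
  refine ⟨S, inferInstance, ρ', ⟨?_, ?_⟩, ?_, F, Algebra.GrothendieckAddGroup M,
    inferInstance, inferInstance, inferInstance, T, hnt, hT, hDT⟩
  · rintro ⟨_, r, rfl⟩
    exact ⟨r, rfl⟩
  · intro r hr
    exact hfaith r fun m => DFunLike.congr_fun (congrArg Subtype.val hr) m
  · have : IsRightCancelAdd S := ⟨fun c a b hab => Subtype.ext (AddMonoidHom.ext fun m =>
      hirr.cancellative _ _ (c.1 m) (by
        exact DFunLike.congr_fun (congrArg Subtype.val hab) m))⟩
    exact AddCommMagma.IsRightCancelAdd.toIsCancelAdd S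

theorem IsSemiisomorphism.isPrimitiveHemiring {R S : Type u} [NonUnitalSemiring R]
    [NonUnitalSemiring S] {f : R →ₙ+* S} (hf : IsSemiisomorphism f) [IsCancelAdd S]
    {F : Type v} {V : Type u} [DivisionRing F] [AddCommGroup V] [Module F V] [Nontrivial V]
    {T : NonUnitalSubring (Module.End F V)} (hT : IsDenseRingOfLinearMaps T)
    (e : RingOfDifferences S ≃+* T) : IsPrimitiveHemiring R := by
  let act : R → Module.End F V := fun r => (e (RingOfDifferences.of (f r))).1
  let inst : LeftSemimodule R V :=
    { smul := fun r v => act r v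
      mul_smul := fun r s m => by
        change act (r * s) m = act r (act s m)
        simp [act, ← RingOfDifferences.of_mul_of]
      smul_add := fun r m n => map_add (act r) m n
      add_smul := fun r s m => by
        change act (r + s) m = act r m + act s m
        simp [act]
      smul_zero := fun r => map_zero (act r)
      zero_smul := fun m => by
        change act 0 m = 0
        simp [act] }
  have hsmul : ∀ (r : R) (v : V), r • v = act r v := fun _ _ => rfl
  refine ⟨V, inferInstance, inst, ⟨inferInstance, fun _ _ _ => add_right_cancel, ?_⟩, ?_⟩
  · intro m₁ m₂ hne m
    -- A single nonzero vector is linearly independent. Writing `t` as `r - s` turns `t (m₁ - m₂) =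
    -- m` into the irreducibility equation, with `s` as the first witness.
    obtain ⟨t, ht, htm⟩ := hT 1 (fun _ => m₁ - m₂) (fun _ => m)
      (LinearIndependent.of_subsingleton 0 (sub_ne_zero.2 hne))
    obtain ⟨a, b, hab⟩ := RingOfDifferences.exists_eq_sub (e.symm ⟨t, ht⟩)
    obtain ⟨r, rfl⟩ := hf.1 a
    obtain ⟨s, rfl⟩ := hf.1 b
    have hact : t = act r - act s := by
      have := congrArg (fun x => (e x).1) hab
      simpa [act] using this
    refine ⟨s, r, ?_⟩
    have := htm 0
    simp only [hact, LinearMap.sub_apply, map_sub] at this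
    simp only [hsmul, ← this]
    abel
  · intro r hr
    apply hf.2
    have hact : act r = 0 := LinearMap.ext hr
    -- Cancellation in `S` turns vanishing in `D(S)` into `f r = 0`, and `f` has zero kernel.
    have h0 : RingOfDifferences.of (f r) = RingOfDifferences.of 0 := by
      rw [map_zero, ← map_eq_zero_iff e e.injective]
      exact Subtype.ext hact
    obtain ⟨c, hc⟩ := RingOfDifferences.of_eq_of_iff.1 h0
    exact add_right_cancel hc

theorem theorem4p5 (R : Type u) [NonUnitalSemiring R] :
    IsPrimitiveHemiring R ↔
      ∃ (S : Type u) (_ : NonUnitalSemiring S) (f : R →ₙ+* S),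
        IsSemiisomorphism f ∧ IsCancelAdd S ∧
        ∃ (F V : Type u) (_ : DivisionRing F) (_ : AddCommGroup V) (_ : Module F V)
          (T : NonUnitalSubring (Module.End F V)),
          Nontrivial V ∧ IsDenseRingOfLinearMaps T ∧ Nonempty (RingOfDifferences S ≃+* T) := by
  refine ⟨IsPrimitiveHemiring.exists_semiisomorphism, ?_⟩
  rintro ⟨S, _, f, hf, _, F, V, _, _, _, T, _, hT, ⟨e⟩⟩
  exact hf.isPrimitiveHemiring hT e
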